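/- Let $G,H$ be random complex $2\times2$ matrices whose eight entries are i.i.d. $\mathcal{CN}(0,1)$, let $\Phi=\mathrm{diag}(e^{i\phi_1},e^{i\phi_2})$ be fixed with real $\phi_1,\phi_2$, and let $\bar\gamma=\rho_s/\sigma^2>0$. Consider the channel $y=G\Phi Hx+n$ with signal $x=as$, signal power $\rho_s$ and noise variance $\sigma^2$. For a unit transmit direction $a$ and a unit combiner $b$ the SNR is $\gamma(a,b)=\bar\gamma\,|b^\dagger G\Phi Ha|^2$. Let $G=U\sqrt{\Lambda}V^\dagger$ and $H=W\sqrt{\Omega}Q^\dagger$ be singular value decompositions with unitary $U,V,W,Q$ (columns $u_j,v_j,w_i,q_i$), $\Lambda=\mathrm{diag}(\lambda_1,\lambda_2)$, $\Omega=\mathrm{diag}(\omega_1,\omega_2)$, $\lambda_1\ge\lambda_2\ge0$, $\omega_1\ge\omega_2\ge0$. Call a pair $(a,b)$ of (channel-dependent) random unit vectors in $\mathbb{C}^2$ admissible if, up to phase factors, both vectors are almost surely measurable functions of $(GG^\dagger,H)$, or both are almost surely measurable functions of $(G,H^\dagger H)$; that is, the choice ignores at least one of the two RIS-side matrices $V$,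 $W$. For example, $a=Q\beta$, $b=U\alpha$ with constant unit vectors $\alpha,\beta$ is admissible if $Q$ and $U$ are chosen as measurable functions of $H^\dagger H$ and $GG^\dagger$. Then all pairs $(q_i,u_j)$ are admissible, and every admissible pair $(a,b)$ has an integrable SNR with $$\mathbb{E}\{\gamma(q_2,u_2)\}\le\mathbb{E}\{\gamma(a,b)\}\le\mathbb{E}\{\gamma(q_1,u_1)\}.$$ Hence $a=q_1$ (leading right singular vector of $H$) and $b=u_1$ (leading left singular vector of $G$) maximize the average SNR over admissible pairs, and $(q_2,u_2)$ minimizes it. Moreover, almost surely $\gamma(q_i,u_j)=\gamma_j^{(i)}:=\bar\gamma\lambda_j\omega_i|v_j^\dagger\Phi w_i|^2$ for $i,j\in\{1,2\}$; these variables are integrable, and $$\mathbb{E}\{\gamma_1^{(1)}\}>\mathbb{E}\{\gamma_2^{(1)}\}=\mathbb{E}\{\gamma_1^{(2)}\}>\mathbb{E}\{\gamma_2^{(2)}\}.$$ -/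

import Mathlib

open MeasureTheory ProbabilityTheory
open scoped Matrix

namespace RIS

/-- Complex `2 × 2` matrices. -/
abbrev Mat := Matrix (Fin 2) (Fin 2) ℂ

/-- The product σ-algebra of the four entries. -/
noncomputable instance : MeasurableSpace Mat := (MeasurableSpace.pi : MeasurableSpace (Fin 2 → Fin 2 → ℂ))

/-- Vectors in `ℂ²`. Their Euclidean norm is used only through `star a ⬝ᵥ a`. -/
abbrev Vec := Fin 2 → ℂ

/-- The law `CN(0,1)`: independent real and imaginary parts, each `N(0,1/2)`. -/
noncomputable def stdComplexGaussian : Measure ℂ :=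
  ((gaussianReal 0 (1 / 2)).prod (gaussianReal 0 (1 / 2))).map
    (fun p : ℝ × ℝ => (⟨p.1, p.2⟩ : ℂ))

/-- The eight entries of `G` and `H` are independent and identically `CN(0,1)` distributed. -/
structure IsRayleigh {Ω : Type*} [MeasurableSpace Ω] (P : Measure Ω) (G H : Ω → Mat) : Prop where
  law_G : ∀ k l, HasLaw (fun x => G x k l) stdComplexGaussian P
  law_H : ∀ k l, HasLaw (fun x => H x k l) stdComplexGaussian P
  indep : iIndepFun (fun (e : (Fin 2 × Fin 2) ⊕ (Fin 2 × Fin 2)) (x : Ω) =>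
    Sum.elim (fun p => G x p.1 p.2) (fun p => H x p.1 p.2) e) P

/-- The RIS reflection matrix `diag(exp(iφ₁), exp(iφ₂))`. -/
noncomputable def phase (φ : Fin 2 → ℝ) : Mat :=
  Matrix.diagonal (fun k => Complex.exp (Complex.I * (φ k : ℂ)))

/-- `M = U √diag(s) V†` is a singular value decomposition with unitary `U`, `V`, in which
`s 0 ≥ s 1 ≥ 0` are the ordered squared singular values of `M`. -/
structure IsOrderedSVD (M U : Mat) (s : Fin 2 → ℝ) (V : Mat) : Prop where
  left_unitary : U ∈ Matrix.unitaryGroup (Fin 2) ℂ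
  right_unitary : V ∈ Matrix.unitaryGroup (Fin 2) ℂ
  nonneg : 0 ≤ s 1
  ordered : s 1 ≤ s 0
  eq : M = U * Matrix.diagonal (fun k => ((Real.sqrt (s k) : ℝ) : ℂ)) * Vᴴ

/-- The instantaneous SNR `γ = (ρ/σ²) |b† G Φ H a|²` of the channel `y = G Φ H x + n` with
`x = a s`, signal power `ρ`, noise variance `σ²` and unit weight vectors `a`, `b`. -/
noncomputable def snr (ρ σ : ℝ) (φ : Fin 2 → ℝ) (G H : Mat) (a b : Vec) : ℝ :=
  ρ / σ ^ 2 * ‖star b ⬝ᵥ ((G * phase φ * H) *ᵥ a)‖ ^ 2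

/-- The mode-wise SNR `γ_j⁽ⁱ⁾ = (ρ/σ²) λ_j ω_i |v_j† Φ w_i|²`, with `v_j`, `w_i` the columns of
`V`, `W`. -/
noncomputable def modeSnr (ρ σ : ℝ) (φ : Fin 2 → ℝ) (lam om : Fin 2 → ℝ) (V W : Mat)
    (i j : Fin 2) : ℝ :=
  ρ / σ ^ 2 * lam j * om i * ‖star (fun k => V k j) ⬝ᵥ (phase φ *ᵥ fun k => W k i)‖ ^ 2

/-- The direction of the random vector `a`, i.e. `a` up to a unimodular factor, as encoded by
the matrix `a a†`, is almost surely a measurable function of the random element `X`. -/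
def DirectionDependsOn {Ω E : Type*} [MeasurableSpace Ω] [MeasurableSpace E] (P : Measure Ω)
    (X : Ω → E) (a : Ω → Vec) : Prop :=
  ∃ T : E → Mat, Measurable T ∧ ∀ᵐ x ∂P, Matrix.vecMulVec (a x) (star (a x)) = T (X x)

/-- The admissible pairs of (channel dependent) transmit directions `a` and combiners `b`: unit
vectors, which are chosen either from `G G†` and `H`, or from `G` and `H† H`. With
`G = U √Λ V†` and `H = W √Ω Q†`, this means that the choice ignores at least one of the two
matrices `V`, `W` of singular vectors at the side of the RIS. -/
structure IsAdmissible {Ω : Type*} [MeasurableSpace Ω] (P : Measure Ω) (G H : Ω → Mat)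
    (a b : Ω → Vec) : Prop where
  unit_a : ∀ᵐ x ∂P, star (a x) ⬝ᵥ a x = 1
  unit_b : ∀ᵐ x ∂P, star (b x) ⬝ᵥ b x = 1
  csi :
    (DirectionDependsOn P (fun x => (G x * (G x)ᴴ, H x)) a ∧
      DirectionDependsOn P (fun x => (G x * (G x)ᴴ, H x)) b) ∨
    (DirectionDependsOn P (fun x => (G x, (H x)ᴴ * H x)) a ∧
      DirectionDependsOn P (fun x => (G x, (H x)ᴴ * H x)) b)

/-- The `i`-th column of a random matrix. -/
def column {Ω : Type*} (A : Ω → Mat) (i : Fin 2) : Ω → Vec := fun x k => A x k i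

end RIS

/-!
The choice of an admissible pair `(a, b)` is blind to one of the two unitary matrices at the side
of the RIS, so the channel may be averaged over that matrix before `a`, `b` are optimized.
Instead of Haar measure it suffices to average over the four Heisenberg–Weyl matrices `R = X^s Z^t`
(`weyl`), products of a coordinate swap and a sign change. They form a unitary `1`-design,
`∑ R M R† = 2 tr(M) I` (`sum_weyl_conj`), and since `G R` and `R H` only permute the independent
symmetric entries and change their signs, `(G R, H)` and `(G, R H)` have the same law as `(G, H)`
(`IsRayleigh.signedPerm`, `IsRayleigh.identDistrib`). Moreover `G R` leaves `(G G†, H)` unchanged and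
`R H` leaves `(G, H† H)` unchanged. Hence in both cases (`IsAdmissible.integral_snr`)
`E γ(a, b) = (ρ / σ²) / 2 * E[‖G† b‖² ‖H a‖²]`.

For unit vectors the two gains lie between the extreme squared singular values, and they are equal
to `λ_j` and `ω_i` at `(q_i, u_j)`. This gives the extremal property, and
`E γ_j⁽ⁱ⁾ = (ρ / σ²) / 2 * E[λ_j ω_i]`. Exchanging `G` and `H` shows `E[λ₂ ω₁] = E[λ₁ ω₂]`. The other two
inequalities are strict because almost surely `λ₁ > λ₂ > 0` and `ω₁ > ω₂ > 0`
(`IsRayleigh.ae_simple_spectrum`): a repeated singular value forces an off-diagonal entry of `G G†`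
to vanish, a zero singular value forces `det G = 0`, and both are affine conditions on the
entry `G₁₁`, whose leading coefficient is almost surely nonzero and whose coefficients are
independent of `G₁₁` (`ae_mul_add_ne_zero`). The simplicity of the spectrum also makes the directions of
`q_i`, `u_j` measurable functions of `H† H` and `G G†`, so that these pairs are admissible.
-/

namespace RIS

/-! ### Gains and singular values -/

/-- The squared Euclidean norm of `M a`. -/
noncomputable def gain (M : Mat) (a : Vec) : ℝ := ∑ k, ‖(M *ᵥ a) k‖ ^ 2

lemma gain_eq_re (M : Mat) (a : Vec) : gain M a = (star a ⬝ᵥ ((Mᴴ * M) *ᵥ a)).re := by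
  rw [← Matrix.mulVec_mulVec, Matrix.dotProduct_mulVec, ← Matrix.star_mulVec]
  simp [gain, dotProduct, Complex.sq_norm, Complex.normSq_apply]
  ring

lemma gain_nonneg (M : Mat) (a : Vec) : 0 ≤ gain M a :=
  Finset.sum_nonneg fun _ _ => by positivity

namespace IsOrderedSVD

variable {M U V : Mat} {s : Fin 2 → ℝ}

lemma nonneg' (h : IsOrderedSVD M U s V) (i : Fin 2) : 0 ≤ s i := by
  fin_cases i
  · exact h.nonneg.trans h.ordered
  · exact h.nonneg

lemma conjTranspose (h : IsOrderedSVD M U s V) : IsOrderedSVD Mᴴ V s U where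
  left_unitary := h.right_unitary
  right_unitary := h.left_unitary
  nonneg := h.nonneg
  ordered := h.ordered
  eq := by
    rw [h.eq, Matrix.conjTranspose_mul, Matrix.conjTranspose_mul, Matrix.diagonal_conjTranspose,
      Matrix.conjTranspose_conjTranspose, ← mul_assoc]
    simp [Pi.star_def]

lemma gram_eq (h : IsOrderedSVD M U s V) :
    Mᴴ * M = V * Matrix.diagonal (fun k => (s k : ℂ)) * Vᴴ := by
  have hU : Uᴴ * U = 1 := Matrix.mem_unitaryGroup_iff'.1 h.left_unitary
  have hd : Matrix.diagonal (fun k => ((Real.sqrt (s k) : ℝ) : ℂ)) *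
      Matrix.diagonal (fun k => ((Real.sqrt (s k) : ℝ) : ℂ)) =
      Matrix.diagonal (fun k => (s k : ℂ)) := by
    rw [Matrix.diagonal_mul_diagonal]
    congr 1
    ext k
    rw [← Complex.ofReal_mul, Real.mul_self_sqrt (h.nonneg' k)]
  have hM := h.conjTranspose.eq
  calc Mᴴ * M = (V * Matrix.diagonal (fun k => ((Real.sqrt (s k) : ℝ) : ℂ)) * Uᴴ) *
        (U * Matrix.diagonal (fun k => ((Real.sqrt (s k) : ℝ) : ℂ)) * Vᴴ) := by rw [← hM, ← h.eq]
    _ = V * (Matrix.diagonal (fun k => ((Real.sqrt (s k) : ℝ) : ℂ)) * (Uᴴ * U) *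
        Matrix.diagonal (fun k => ((Real.sqrt (s k) : ℝ) : ℂ))) * Vᴴ := by
        simp only [mul_assoc]
    _ = _ := by rw [hU, mul_one, hd]

/-- In the orthonormal basis of right singular vectors, `‖M a‖²` is a weighted sum of the squared
singular values. -/
lemma gain_eq_sum (h : IsOrderedSVD M U s V) (a : Vec) :
    gain M a = ∑ i, s i * ‖(Vᴴ *ᵥ a) i‖ ^ 2 := by
  have : star a ⬝ᵥ ((Mᴴ * M) *ᵥ a) =
      star (Vᴴ *ᵥ a) ⬝ᵥ (Matrix.diagonal (fun k => (s k : ℂ)) *ᵥ (Vᴴ *ᵥ a)) := by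
    rw [h.gram_eq, Matrix.star_mulVec, Matrix.conjTranspose_conjTranspose,
      ← Matrix.dotProduct_mulVec, Matrix.mulVec_mulVec, Matrix.mulVec_mulVec]
  rw [gain_eq_re, this]
  simp [dotProduct, Complex.sq_norm, Complex.normSq_apply, Matrix.mulVec_diagonal]
  ring

lemma sum_sq_eq_one (h : IsOrderedSVD M U s V) {a : Vec} (ha : star a ⬝ᵥ a = 1) :
    ∑ i, ‖(Vᴴ *ᵥ a) i‖ ^ 2 = 1 := by
  have hV : V * Vᴴ = 1 := Matrix.mem_unitaryGroup_iff.1 h.right_unitary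
  have := gain_eq_re Vᴴ a
  rw [Matrix.conjTranspose_conjTranspose, hV, Matrix.one_mulVec, ha] at this
  simpa [gain] using this

lemma gain_le (h : IsOrderedSVD M U s V) {a : Vec} (ha : star a ⬝ᵥ a = 1) : gain M a ≤ s 0 := by
  have h1 := h.sum_sq_eq_one ha
  rw [h.gain_eq_sum]
  rw [Fin.sum_univ_two] at h1 ⊢
  rw [eq_sub_of_add_eq h1]
  nlinarith [mul_nonneg (sub_nonneg.2 h.ordered) (sq_nonneg ‖(Vᴴ *ᵥ a) 1‖)]

lemma le_gain (h : IsOrderedSVD M U s V) {a : Vec} (ha : star a ⬝ᵥ a = 1) : s 1 ≤ gain M a := by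
  have h1 := h.sum_sq_eq_one ha
  rw [h.gain_eq_sum]
  rw [Fin.sum_univ_two] at h1 ⊢
  rw [eq_sub_of_add_eq' h1]
  nlinarith [mul_nonneg (sub_nonneg.2 h.ordered) (sq_nonneg ‖(Vᴴ *ᵥ a) 0‖)]

lemma conjTranspose_mulVec_col (h : IsOrderedSVD M U s V) (i : Fin 2) :
    Vᴴ *ᵥ (fun k => V k i) = Pi.single i 1 := by
  have hV : Vᴴ * V = 1 := Matrix.mem_unitaryGroup_iff'.1 h.right_unitary
  ext k
  have := congrFun (congrFun hV k) i
  rw [Matrix.mul_apply] at this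
  simp only [Matrix.mulVec, dotProduct, this, Matrix.one_apply, Pi.single_apply]

lemma gain_col (h : IsOrderedSVD M U s V) (i : Fin 2) : gain M (fun k => V k i) = s i := by
  rw [h.gain_eq_sum, h.conjTranspose_mulVec_col, Fintype.sum_eq_single i]
  · simp
  · intro j hj
    simp [hj]

lemma unit_col (h : IsOrderedSVD M U s V) (i : Fin 2) :
    star (fun k => V k i) ⬝ᵥ (fun k => V k i) = 1 := by
  have hV : Vᴴ * V = 1 := Matrix.mem_unitaryGroup_iff'.1 h.right_unitary
  have := congrFun (congrFun hV i) i
  rw [Matrix.mul_apply] at this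
  simpa [dotProduct, Matrix.conjTranspose_apply] using this

lemma mulVec_col (h : IsOrderedSVD M U s V) (i : Fin 2) :
    M *ᵥ (fun k => V k i) = ((Real.sqrt (s i) : ℝ) : ℂ) • fun k => U k i := by
  rw [h.eq, ← Matrix.mulVec_mulVec, h.conjTranspose_mulVec_col, ← Matrix.mulVec_mulVec,
    Matrix.diagonal_mulVec_single]
  ext k
  simp [Matrix.mulVec_single, mul_comm]

lemma trace_gram (h : IsOrderedSVD M U s V) : (Mᴴ * M).trace = ((s 0 + s 1 : ℝ) : ℂ) := by
  have hV : Vᴴ * V = 1 := Matrix.mem_unitaryGroup_iff'.1 h.right_unitary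
  rw [h.gram_eq, Matrix.trace_mul_comm, ← mul_assoc, hV, one_mul, Matrix.trace_diagonal]
  simp

lemma det_gram (h : IsOrderedSVD M U s V) : (Mᴴ * M).det = ((s 0 * s 1 : ℝ) : ℂ) := by
  have hV : Vᴴ * V = 1 := Matrix.mem_unitaryGroup_iff'.1 h.right_unitary
  rw [h.gram_eq, Matrix.det_mul_comm, ← mul_assoc, hV, one_mul, Matrix.det_diagonal]
  simp

lemma le_sum_sq (h : IsOrderedSVD M U s V) (i : Fin 2) : s i ≤ ∑ k, ∑ l, ‖M k l‖ ^ 2 := by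
  have h1 : s 0 + s 1 = ∑ k, ∑ l, ‖M k l‖ ^ 2 := by
    have := congrArg Complex.re h.trace_gram
    simp [Matrix.trace, Matrix.mul_apply, Complex.sq_norm, Complex.normSq_apply] at this ⊢
    linarith
  rw [← h1]
  fin_cases i <;> simp [h.nonneg, h.nonneg' 0]

end IsOrderedSVD

/-! ### Eigenvalues and eigenprojections from trace and determinant -/

/-- The larger (`i = 0`) and the smaller (`i = 1`) root of the characteristic polynomial of a
Hermitian matrix `A`, as explicit functions of its trace and determinant. -/
noncomputable def eig (A : Mat) (i : Fin 2) : ℝ :=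
  (A.trace.re + (-1) ^ (i : ℕ) * Real.sqrt (A.trace.re ^ 2 - 4 * A.det.re)) / 2

/-- The orthogonal projection onto the eigenspace of `eig A i`, for a Hermitian matrix `A` with
distinct eigenvalues; the inverse is `0` when the eigenvalues coincide. -/
noncomputable def eigProj (A : Mat) (i : Fin 2) : Mat :=
  ((eig A i - eig A (i + 1))⁻¹ : ℝ) • (A - ((eig A (i + 1) : ℝ) : ℂ) • (1 : Mat))

namespace IsOrderedSVD

variable {M U V : Mat} {s : Fin 2 → ℝ}

lemma eig_gram (h : IsOrderedSVD M U s V) : eig (Mᴴ * M) = s := by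
  have hd : Real.sqrt ((s 0 + s 1) ^ 2 - 4 * (s 0 * s 1)) = s 0 - s 1 := by
    rw [← Real.sqrt_sq (sub_nonneg.2 h.ordered)]
    congr 1
    ring
  ext i
  rw [eig, h.trace_gram, h.det_gram, Complex.ofReal_re, Complex.ofReal_re, hd]
  fin_cases i
  · simp
  · simp
    ring

lemma eigProj_gram (h : IsOrderedSVD M U s V) (hs : s 1 < s 0) (i : Fin 2) :
    Matrix.vecMulVec (fun k => V k i) (star fun k => V k i) = eigProj (Mᴴ * M) i := by
  have hV : V * Vᴴ = 1 := Matrix.mem_unitaryGroup_iff.1 h.right_unitary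
  have hne : s i - s (i + 1) ≠ 0 := by
    fin_cases i <;> simp <;> linarith
  rw [eigProj, h.eig_gram, eq_inv_smul_iff₀ hne, h.gram_eq, ← hV]
  ext k l
  fin_cases i <;> simp [Matrix.mul_apply, Matrix.vecMulVec_apply, Matrix.diagonal_apply] <;> ring

/-- If the singular values coincide then the Gram matrix is scalar. -/
lemma gram_offDiag_eq_zero (h : IsOrderedSVD M U s V) (hs : s 0 = s 1) :
    (Mᴴ * M) 0 1 = 0 := by
  have hV : V * Vᴴ = 1 := Matrix.mem_unitaryGroup_iff.1 h.right_unitary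
  have hd : Matrix.diagonal (fun k => (s k : ℂ)) = (s 0 : ℂ) • (1 : Mat) := by
    ext k l
    fin_cases k <;> fin_cases l <;> simp [hs]
  rw [h.gram_eq, hd, mul_smul_comm, mul_one, smul_mul_assoc, hV]
  simp

lemma det_eq_zero (h : IsOrderedSVD M U s V) (hs : s 1 = 0) : M.det = 0 := by
  have := h.det_gram
  rw [hs, mul_zero, Matrix.det_mul, Matrix.det_conjTranspose] at this
  simpa using this

end IsOrderedSVD

/-! ### The received power and averaging over Heisenberg–Weyl matrices -/

lemma phase_mul_conjTranspose (φ : Fin 2 → ℝ) : phase φ * (phase φ)ᴴ = 1 := by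
  rw [phase, Matrix.diagonal_conjTranspose, Matrix.diagonal_mul_diagonal, ← Matrix.diagonal_one]
  congr 1
  ext k
  simp [← Complex.exp_conj, ← Complex.exp_add]

lemma conjTranspose_mul_phase (φ : Fin 2 → ℝ) : (phase φ)ᴴ * phase φ = 1 :=
  mul_eq_one_comm.1 (phase_mul_conjTranspose φ)

/-- The received power `|b† G Φ H a|²` as a function of the matrices `X = a a†` and
`Y = b b†`. -/
noncomputable def received (φ : Fin 2 → ℝ) (G H X Y : Mat) : ℝ :=
  (((G * phase φ * H) * X * (G * phase φ * H)ᴴ) * Y).trace.re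

lemma trace_conj_vecMulVec (M : Mat) (a b : Vec) :
    ((M * Matrix.vecMulVec a (star a) * Mᴴ) * Matrix.vecMulVec b (star b)).trace =
      ((‖star b ⬝ᵥ (M *ᵥ a)‖ ^ 2 : ℝ) : ℂ) := by
  rw [Matrix.mul_vecMulVec M, Matrix.vecMulVec_mul, ← Matrix.star_mulVec,
    Matrix.vecMulVec_mul_vecMulVec, Matrix.trace_vecMulVec, dotProduct_smul,
    dotProduct_comm (M *ᵥ a) (star b)]
  have h : star (M *ᵥ a) ⬝ᵥ b = star (star b ⬝ᵥ (M *ᵥ a)) := by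
    simp [dotProduct, mul_comm]
  rw [h, smul_eq_mul, ← starRingEnd_apply, mul_comm, Complex.mul_conj, Complex.sq_norm]

lemma snr_eq_received (ρ σ : ℝ) (φ : Fin 2 → ℝ) (G H : Mat) (a b : Vec) :
    snr ρ σ φ G H a b = ρ / σ ^ 2 *
      received φ G H (Matrix.vecMulVec a (star a)) (Matrix.vecMulVec b (star b)) := by
  rw [snr, received, trace_conj_vecMulVec, Complex.ofReal_re]

lemma trace_gain (M : Mat) (a : Vec) :
    (M * Matrix.vecMulVec a (star a) * Mᴴ).trace = (gain M a : ℂ) := by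
  rw [Matrix.mul_vecMulVec, Matrix.vecMulVec_mul, ← Matrix.star_mulVec, Matrix.trace_vecMulVec]
  simp [dotProduct, gain, Complex.mul_conj, Complex.sq_norm]

/-- The Heisenberg–Weyl matrices `X^s Z^t`, where `X` swaps the coordinates and `Z` negates the
second one. -/
def weyl (r : Fin 2 × Fin 2) : Mat :=
  Matrix.of fun k l => if k = l + r.1 then (-1) ^ ((r.2 * l : Fin 2) : ℕ) else 0

lemma weyl_mul_conjTranspose (r : Fin 2 × Fin 2) : weyl r * (weyl r)ᴴ = 1 := by
  obtain ⟨s, t⟩ := r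
  ext k l
  fin_cases s <;> fin_cases t <;> fin_cases k <;> fin_cases l <;>
    simp [weyl, Matrix.mul_apply]

lemma conjTranspose_mul_weyl (r : Fin 2 × Fin 2) : (weyl r)ᴴ * weyl r = 1 :=
  mul_eq_one_comm.1 (weyl_mul_conjTranspose r)

lemma mul_weyl_apply (M : Mat) (r : Fin 2 × Fin 2) (k l : Fin 2) :
    (M * weyl r) k l = (-1) ^ ((r.2 * l : Fin 2) : ℕ) * M k (l + r.1) := by
  obtain ⟨s, t⟩ := r
  fin_cases s <;> fin_cases t <;> fin_cases k <;> fin_cases l <;>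
    simp [weyl, Matrix.mul_apply]

lemma weyl_mul_apply (M : Mat) (r : Fin 2 × Fin 2) (k l : Fin 2) :
    (weyl r * M) k l = (-1) ^ ((r.2 * (k + r.1) : Fin 2) : ℕ) * M (k + r.1) l := by
  obtain ⟨s, t⟩ := r
  fin_cases s <;> fin_cases t <;> fin_cases k <;> fin_cases l <;>
    simp [weyl, Matrix.mul_apply]

/-- The Heisenberg–Weyl matrices form a unitary `1`-design. -/
lemma sum_weyl_conj (M : Mat) :
    ∑ r, weyl r * M * (weyl r)ᴴ = (2 * M.trace) • (1 : Mat) := by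
  ext k l
  rw [Fintype.sum_prod_type]
  fin_cases k <;> fin_cases l <;>
    simp [weyl, Matrix.mul_apply, Matrix.trace] <;> ring

/-- Averaging over Heisenberg–Weyl matrices inserted between the factors of `S T` decouples
the two factors. -/
lemma sum_trace_weyl (S T X Y : Mat) :
    ∑ r, ((S * weyl r * T) * X * (S * weyl r * T)ᴴ * Y).trace =
      2 * (T * X * Tᴴ).trace * (Sᴴ * Y * S).trace := by
  have h (r) : ((S * weyl r * T) * X * (S * weyl r * T)ᴴ * Y).trace =
      ((weyl r * (T * X * Tᴴ) * (weyl r)ᴴ) * (Sᴴ * Y * S)).trace := by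
    rw [Matrix.conjTranspose_mul, Matrix.conjTranspose_mul]
    simp only [mul_assoc]
    rw [Matrix.trace_mul_comm S]
    simp only [mul_assoc]
  simp_rw [h]
  rw [← Matrix.trace_sum, ← Finset.sum_mul, sum_weyl_conj, smul_mul_assoc, one_mul,
    Matrix.trace_smul, smul_eq_mul]

lemma sum_received_mul_weyl (φ : Fin 2 → ℝ) (G H X Y : Mat) :
    ∑ r, received φ (G * weyl r) H X Y =
      (2 * (H * X * Hᴴ).trace * (Gᴴ * Y * G).trace).re := by
  have ht : (phase φ * H * X * (phase φ * H)ᴴ).trace = (H * X * Hᴴ).trace := by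
    rw [Matrix.conjTranspose_mul, mul_assoc, mul_assoc, Matrix.trace_mul_comm]
    simp only [mul_assoc]
    rw [conjTranspose_mul_phase, mul_one]
  rw [← ht, ← sum_trace_weyl, Complex.re_sum]
  simp only [received, mul_assoc]

lemma sum_received_weyl_mul (φ : Fin 2 → ℝ) (G H X Y : Mat) :
    ∑ r, received φ G (weyl r * H) X Y =
      (2 * (H * X * Hᴴ).trace * (Gᴴ * Y * G).trace).re := by
  have ht : ((G * phase φ)ᴴ * Y * (G * phase φ)).trace = (Gᴴ * Y * G).trace := by
    rw [Matrix.conjTranspose_mul, mul_assoc, mul_assoc, Matrix.trace_mul_comm]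
    simp only [mul_assoc]
    rw [phase_mul_conjTranspose, mul_one]
  rw [← ht, ← sum_trace_weyl, Complex.re_sum]
  simp only [received, mul_assoc]

lemma norm_star_dotProduct_sq_le (x y : Vec) :
    ‖star x ⬝ᵥ y‖ ^ 2 ≤ (∑ k, ‖x k‖ ^ 2) * ∑ k, ‖y k‖ ^ 2 := by
  have h : ‖star x ⬝ᵥ y‖ ≤ ‖x 0‖ * ‖y 0‖ + ‖x 1‖ * ‖y 1‖ := by
    simpa [dotProduct] using norm_add_le (star (x 0) * y 0) (star (x 1) * y 1)
  calc ‖star x ⬝ᵥ y‖ ^ 2 ≤ (‖x 0‖ * ‖y 0‖ + ‖x 1‖ * ‖y 1‖) ^ 2 := by gcongr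
    _ ≤ _ := by
      simp only [Fin.sum_univ_two]
      nlinarith [sq_nonneg (‖x 0‖ * ‖y 1‖ - ‖x 1‖ * ‖y 0‖)]

lemma norm_phase_mulVec (φ : Fin 2 → ℝ) (v : Vec) (k : Fin 2) : ‖(phase φ *ᵥ v) k‖ = ‖v k‖ := by
  rw [phase, Matrix.mulVec_diagonal, norm_mul, mul_comm Complex.I, Complex.norm_exp_ofReal_mul_I,
    one_mul]

lemma snr_le {ρ σ : ℝ} (hρ : 0 < ρ) (φ : Fin 2 → ℝ) (G H : Mat) (a b : Vec) :
    snr ρ σ φ G H a b ≤ ρ / σ ^ 2 * (gain Gᴴ b * gain H a) := by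
  have h : star b ⬝ᵥ ((G * phase φ * H) *ᵥ a) = star (Gᴴ *ᵥ b) ⬝ᵥ (phase φ *ᵥ (H *ᵥ a)) := by
    rw [mul_assoc, ← Matrix.mulVec_mulVec, Matrix.dotProduct_mulVec, ← Matrix.mulVec_mulVec,
      Matrix.star_mulVec, Matrix.conjTranspose_conjTranspose]
  rw [snr, h]
  gcongr
  refine (norm_star_dotProduct_sq_le _ _).trans_eq ?_
  simp only [norm_phase_mulVec, gain]

lemma snr_nonneg {ρ σ : ℝ} (hρ : 0 < ρ) (φ : Fin 2 → ℝ) (G H : Mat) (a b : Vec) :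
    0 ≤ snr ρ σ φ G H a b := by
  unfold snr
  positivity

lemma snr_col {G U V H W Q : Mat} {lam om : Fin 2 → ℝ} (hG : IsOrderedSVD G U lam V)
    (hH : IsOrderedSVD H W om Q) (ρ σ : ℝ) (φ : Fin 2 → ℝ) (i j : Fin 2) :
    snr ρ σ φ G H (fun k => Q k i) (fun k => U k j) = modeSnr ρ σ φ lam om V W i j := by
  have h1 := hH.mulVec_col i
  have h2 := hG.conjTranspose.mulVec_col j
  have h3 : star (fun k => U k j) ⬝ᵥ ((G * phase φ * H) *ᵥ fun k => Q k i) =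
      ((Real.sqrt (lam j) * Real.sqrt (om i) : ℝ) : ℂ) *
        (star (fun k => V k j) ⬝ᵥ (phase φ *ᵥ fun k => W k i)) := by
    rw [mul_assoc, ← Matrix.mulVec_mulVec, Matrix.dotProduct_mulVec,
      ← Matrix.conjTranspose_conjTranspose G, ← Matrix.star_mulVec, h2, ← Matrix.mulVec_mulVec, h1,
      Matrix.mulVec_smul, dotProduct_smul, star_smul, smul_dotProduct]
    simp
    ring
  rw [snr, modeSnr, h3, norm_mul, mul_pow, Complex.norm_real, Real.norm_eq_abs, sq_abs, mul_pow,
    Real.sq_sqrt (hG.nonneg' j), Real.sq_sqrt (hH.nonneg' i)]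
  ring

/-! ### Measurability of matrix operations -/

section Measurability

variable {E : Type*} [MeasurableSpace E]

lemma measurable_mat_iff {f : E → Mat} : Measurable f ↔ ∀ k l, Measurable fun x => f x k l := by
  exact measurable_pi_iff.trans (forall_congr' fun k => measurable_pi_iff)

lemma aemeasurable_mat_iff {P : Measure E} {f : E → Mat} :
    AEMeasurable f P ↔ ∀ k l, AEMeasurable (fun x => f x k l) P := by
  exact aemeasurable_pi_iff.trans (forall_congr' fun k => aemeasurable_pi_iff)

lemma measurable_entry {f : E → Mat} (hf : Measurable f) (k l : Fin 2) :
    Measurable fun x => f x k l :=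
  measurable_mat_iff.1 hf k l

lemma measurable_mat_mul {f g : E → Mat} (hf : Measurable f) (hg : Measurable g) :
    Measurable fun x => f x * g x := by
  refine measurable_mat_iff.2 fun k l => ?_
  simp only [Matrix.mul_apply]
  exact Finset.measurable_sum _ fun i _ => (measurable_entry hf k i).mul (measurable_entry hg i l)

lemma measurable_mat_conjTranspose {f : E → Mat} (hf : Measurable f) :
    Measurable fun x => (f x)ᴴ :=
  measurable_mat_iff.2 fun k l => continuous_star.measurable.comp (measurable_entry hf l k)

lemma measurable_mat_trace {f : E → Mat} (hf : Measurable f) :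
    Measurable fun x => (f x).trace := by
  simp only [Matrix.trace, Matrix.diag]
  exact Finset.measurable_sum _ fun i _ => measurable_entry hf i i

lemma measurable_mat_det {f : E → Mat} (hf : Measurable f) :
    Measurable fun x => (f x).det := by
  simp only [Matrix.det_fin_two]
  exact ((measurable_entry hf 0 0).mul (measurable_entry hf 1 1)).sub
    ((measurable_entry hf 0 1).mul (measurable_entry hf 1 0))

lemma measurable_eig (i : Fin 2) : Measurable fun A : Mat => eig A i := by
  have h1 := Complex.measurable_re.comp (measurable_mat_trace (measurable_id (α := Mat)))
  have h2 := Complex.measurable_re.comp (measurable_mat_det (measurable_id (α := Mat)))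
  exact (h1.add (((h1.pow_const 2).sub (h2.const_mul 4)).sqrt.const_mul _)).div_const 2

lemma measurable_eigProj (i : Fin 2) : Measurable fun A : Mat => eigProj A i := by
  refine measurable_mat_iff.2 fun k l => ?_
  simp only [eigProj, Matrix.smul_apply, Matrix.sub_apply]
  exact ((measurable_eig i).sub (measurable_eig (i + 1))).inv.smul
    ((measurable_entry measurable_id k l).sub
      ((Complex.measurable_ofReal.comp (measurable_eig (i + 1))).smul_const _))

lemma measurable_received (φ : Fin 2 → ℝ) {G H X Y : E → Mat} (hG : Measurable G)
    (hH : Measurable H) (hX : Measurable X) (hY : Measurable Y) :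
    Measurable fun x => received φ (G x) (H x) (X x) (Y x) := by
  have hM := measurable_mat_mul (measurable_mat_mul hG (measurable_const (a := phase φ))) hH
  exact Complex.measurable_re.comp (measurable_mat_trace (measurable_mat_mul
    (measurable_mat_mul (measurable_mat_mul hM hX) (measurable_mat_conjTranspose hM)) hY))

end Measurability

/-! ### The complex Gaussian law -/

instance : IsProbabilityMeasure stdComplexGaussian :=
  Measure.isProbabilityMeasure_map (by
    apply Measurable.aemeasurable
    exact Complex.measurableEquivRealProd.symm.measurable)

lemma measurable_toComplex : Measurable fun p : ℝ × ℝ => (⟨p.1, p.2⟩ : ℂ) :=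
  Complex.measurableEquivRealProd.symm.measurable

lemma stdComplexGaussian_singleton (z : ℂ) : stdComplexGaussian {z} = 0 := by
  have h : (fun p : ℝ × ℝ => (⟨p.1, p.2⟩ : ℂ)) ⁻¹' {z} ⊆ {z.re} ×ˢ Set.univ := by
    rintro p rfl
    simp
  have := nullSingletonClass_gaussianReal (μ := 0) (v := 1 / 2) (by norm_num)
  rw [stdComplexGaussian, Measure.map_apply measurable_toComplex (measurableSet_singleton z)]
  refine measure_mono_null h ?_
  rw [Measure.prod_prod, measure_singleton, zero_mul]

lemma map_neg_stdComplexGaussian : stdComplexGaussian.map (fun z => -z) = stdComplexGaussian := by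
  have h : (gaussianReal 0 (1 / 2)).map (fun x => -x) = gaussianReal 0 (1 / 2) := by
    rw [gaussianReal_map_neg, neg_zero]
  rw [stdComplexGaussian, Measure.map_map measurable_neg measurable_toComplex]
  nth_rewrite 3 [← h]
  nth_rewrite 4 [← h]
  rw [Measure.map_prod_map _ _ measurable_neg measurable_neg, Measure.map_map measurable_toComplex
    (by fun_prop)]
  congr 1

lemma integrable_sq_norm_stdComplexGaussian :
    Integrable (fun z : ℂ => ‖z‖ ^ 2) stdComplexGaussian := by
  have h : Integrable (fun x : ℝ => x ^ 2) (gaussianReal 0 (1 / 2)) :=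
    (memLp_id_gaussianReal 2).integrable_sq
  rw [stdComplexGaussian, integrable_map_measure
    (measurable_norm.pow_const 2).aestronglyMeasurable measurable_toComplex.aemeasurable]
  refine ((h.comp_fst (gaussianReal 0 (1 / 2))).add (h.comp_snd (gaussianReal 0 (1 / 2)))).congr ?_
  refine Filter.Eventually.of_forall fun p => ?_
  simp only [Function.comp_apply, Pi.add_apply, Complex.sq_norm, Complex.normSq_apply]
  ring

/-- An affine function with random coefficients of an independent random variable without atoms
does not vanish where its leading coefficient does not vanish. -/
lemma ae_mul_add_ne_zero {Ω : Type*} [MeasurableSpace Ω] {P : Measure Ω} [IsProbabilityMeasure P]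
    {X : Ω → ℂ} {R : Ω → ℂ × ℂ} (hX : HasLaw X stdComplexGaussian P) (hR : AEMeasurable R P)
    (hXR : IndepFun X R P) (h0 : ∀ᵐ x ∂P, (R x).1 ≠ 0) :
    ∀ᵐ x ∂P, X x * (R x).1 + (R x).2 ≠ 0 := by
  have hs : MeasurableSet {p : (ℂ × ℂ) × ℂ | p.2 * p.1.1 + p.1.2 = 0 ∧ p.1.1 ≠ 0} := by
    refine MeasurableSet.inter (measurableSet_eq_fun (by fun_prop) (by fun_prop)) ?_
    exact (measurableSet_eq_fun (by fun_prop) (by fun_prop)).compl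
  have hlaw := (indepFun_iff_map_prod_eq_prod_map_map hR hX.aemeasurable).1 hXR.symm
  have hnull : P.map (fun x => (R x, X x))
      {p : (ℂ × ℂ) × ℂ | p.2 * p.1.1 + p.1.2 = 0 ∧ p.1.1 ≠ 0} = 0 := by
    rw [hlaw, hX.map_eq]
    refine Measure.measure_prod_null_of_ae_null hs (Filter.Eventually.of_forall fun r => ?_)
    refine measure_mono_null ?_ (stdComplexGaussian_singleton (-r.2 / r.1))
    rintro z ⟨h1, h2⟩
    rw [Set.mem_singleton_iff, eq_div_iff h2]
    exact eq_neg_of_add_eq_zero_left h1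
  rw [Measure.map_apply_of_aemeasurable (hR.prodMk hX.aemeasurable) hs] at hnull
  filter_upwards [measure_eq_zero_iff_ae_notMem.1 hnull, h0] with x hx hx0 h
  exact hx ⟨h, hx0⟩

/-! ### Symmetries and null sets of the Rayleigh model -/

/-- The eight entries of a pair of matrices, as one family. -/
abbrev entries (G H : Mat) (e : (Fin 2 × Fin 2) ⊕ (Fin 2 × Fin 2)) : ℂ :=
  Sum.elim (fun p => G p.1 p.2) (fun p => H p.1 p.2) e

namespace IsRayleigh

variable {Ω : Type*} [MeasurableSpace Ω] {P : Measure Ω} {G H : Ω → Mat}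

lemma hasLaw_entry (h : IsRayleigh P G H) (e : (Fin 2 × Fin 2) ⊕ (Fin 2 × Fin 2)) :
    HasLaw (fun x => entries (G x) (H x) e) stdComplexGaussian P := by
  rcases e with p | p
  · exact h.law_G p.1 p.2
  · exact h.law_H p.1 p.2

lemma aemeasurable_left (h : IsRayleigh P G H) : AEMeasurable G P :=
  aemeasurable_mat_iff.2 fun k l => (h.law_G k l).aemeasurable

lemma aemeasurable_right (h : IsRayleigh P G H) : AEMeasurable H P :=
  aemeasurable_mat_iff.2 fun k l => (h.law_H k l).aemeasurable

/-- Permuting the eight entries and changing some of their signs preserves the Rayleigh model. -/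
lemma signedPerm (h : IsRayleigh P G H) {G' H' : Ω → Mat}
    (π : Equiv.Perm ((Fin 2 × Fin 2) ⊕ (Fin 2 × Fin 2)))
    (n : (Fin 2 × Fin 2) ⊕ (Fin 2 × Fin 2) → ℕ)
    (h' : ∀ e x, entries (G' x) (H' x) e = (-1) ^ n e * entries (G x) (H x) (π e)) :
    IsRayleigh P G' H' := by
  have hneg (m : ℕ) : HasLaw (fun z : ℂ => (-1) ^ m * z) stdComplexGaussian stdComplexGaussian := by
    refine ⟨by fun_prop, ?_⟩
    rcases Nat.even_or_odd m with hm | hm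
    · simp only [hm.neg_one_pow, one_mul]
      exact Measure.map_id
    · simp only [hm.neg_one_pow, neg_one_mul]
      exact map_neg_stdComplexGaussian
  have hlaw (e) : HasLaw (fun x => entries (G' x) (H' x) e) stdComplexGaussian P := by
    simp only [h']
    exact (hneg (n e)).fun_comp (h.hasLaw_entry (π e))
  refine ⟨fun k l => hlaw (Sum.inl (k, l)), fun k l => hlaw (Sum.inr (k, l)), ?_⟩
  change iIndepFun (fun e x => entries (G' x) (H' x) e) P
  simp only [h']
  exact (h.indep.precomp π.injective).comp (fun e z => (-1) ^ n e * z) fun e => by fun_prop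

lemma swap (h : IsRayleigh P G H) : IsRayleigh P H G :=
  h.signedPerm (Equiv.sumComm _ _) (fun _ => 0) (by rintro (p | p) x <;> simp)

lemma mul_weyl (h : IsRayleigh P G H) (r : Fin 2 × Fin 2) :
    IsRayleigh P (fun x => G x * weyl r) H :=
  h.signedPerm (Equiv.sumCongr (Equiv.prodCongr (Equiv.refl _) (Equiv.addRight r.1)) (Equiv.refl _))
    (Sum.elim (fun p => ((r.2 * p.2 : Fin 2) : ℕ)) fun _ => 0)
    (by rintro (p | p) x <;> simp [mul_weyl_apply])

lemma weyl_mul (h : IsRayleigh P G H) (r : Fin 2 × Fin 2) :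
    IsRayleigh P G (fun x => weyl r * H x) :=
  h.signedPerm (Equiv.sumCongr (Equiv.refl _) (Equiv.prodCongr (Equiv.addRight r.1) (Equiv.refl _)))
    (Sum.elim (fun _ => 0) fun p => ((r.2 * (p.1 + r.1) : Fin 2) : ℕ))
    (by rintro (p | p) x <;> simp [weyl_mul_apply])

lemma ae_entry_ne_zero (h : IsRayleigh P G H) (k l : Fin 2) : ∀ᵐ x ∂P, G x k l ≠ 0 := by
  have h1 : ∀ᵐ z ∂stdComplexGaussian, z ≠ 0 :=
    measure_eq_zero_iff_ae_notMem.1 (stdComplexGaussian_singleton 0)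
  rw [← (h.law_G k l).map_eq] at h1
  exact ae_of_ae_map (h.law_G k l).aemeasurable h1

/-- The product of the squared Frobenius norms has finite mean. -/
lemma integrable_frobenius (h : IsRayleigh P G H) :
    Integrable (fun x => (∑ k, ∑ l, ‖G x k l‖ ^ 2) * ∑ k, ∑ l, ‖H x k l‖ ^ 2) P := by
  have hi {X : Ω → ℂ} (hX : HasLaw X stdComplexGaussian P) :
      Integrable (fun x => ‖X x‖ ^ 2) P := by
    have := integrable_sq_norm_stdComplexGaussian
    rw [← hX.map_eq] at this
    exact this.comp_aemeasurable hX.aemeasurable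
  simp only [Finset.sum_mul, Finset.mul_sum]
  refine integrable_finsetSum _ fun k _ => integrable_finsetSum _ fun l _ =>
    integrable_finsetSum _ fun m _ => integrable_finsetSum _ fun n _ => ?_
  have hind := h.indep.indepFun (i := Sum.inl (m, n)) (j := Sum.inr (k, l)) (by simp)
  exact (hind.comp (φ := fun z : ℂ => ‖z‖ ^ 2) (ψ := fun z : ℂ => ‖z‖ ^ 2) (by fun_prop)
    (by fun_prop)).integrable_mul (hi (h.law_G m n)) (hi (h.law_H k l))

lemma indepFun_zero_zero (h : IsRayleigh P G H) :
    IndepFun (fun x => G x 0 0) (fun x => (G x 0 1, G x 1 0, G x 1 1)) P := by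
  have h1 : Measurable fun z : ({Sum.inl (0, 0)} : Finset ((Fin 2 × Fin 2) ⊕ (Fin 2 × Fin 2))) → ℂ =>
      z ⟨Sum.inl (0, 0), by decide⟩ := measurable_pi_apply _
  have h2 : Measurable fun z : ({Sum.inl (0, 1), Sum.inl (1, 0), Sum.inl (1, 1)} :
      Finset ((Fin 2 × Fin 2) ⊕ (Fin 2 × Fin 2))) → ℂ =>
      (z ⟨Sum.inl (0, 1), by decide⟩, z ⟨Sum.inl (1, 0), by decide⟩,
        z ⟨Sum.inl (1, 1), by decide⟩) :=
    (measurable_pi_apply _).prodMk ((measurable_pi_apply _).prodMk (measurable_pi_apply _))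
  exact (h.indep.indepFun_finset₀ _ _ (by decide)
    fun e => (h.hasLaw_entry e).aemeasurable).comp h1 h2

variable [IsProbabilityMeasure P]

/-- The Rayleigh model determines the joint law of the two channels. -/
lemma identDistrib (h : IsRayleigh P G H) {G' H' : Ω → Mat} (h' : IsRayleigh P G' H') :
    IdentDistrib (fun x => (G x, H x)) (fun x => (G' x, H' x)) P P := by
  have key {G H : Ω → Mat} (h : IsRayleigh P G H) : HasLaw
      (fun x => entries (G x) (H x))
      (Measure.pi fun _ => stdComplexGaussian) P := by
    refine ⟨aemeasurable_pi_iff.2 fun e => (h.hasLaw_entry e).aemeasurable, ?_⟩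
    rw [(iIndepFun_iff_map_fun_eq_pi_map fun e => (h.hasLaw_entry e).aemeasurable).1 h.indep]
    exact congrArg Measure.pi (funext fun e => (h.hasLaw_entry e).map_eq)
  have hu : Measurable fun z : (Fin 2 × Fin 2) ⊕ (Fin 2 × Fin 2) → ℂ =>
      ((fun k l => z (Sum.inl (k, l)), fun k l => z (Sum.inr (k, l))) : Mat × Mat) := by
    refine Measurable.prodMk ?_ ?_ <;>
    exact measurable_mat_iff.2 fun k l => measurable_pi_apply _
  exact ((key h).identDistrib (key h')).comp hu

lemma ae_affine_ne_zero (h : IsRayleigh P G H) {g : ℂ × ℂ × ℂ → ℂ × ℂ} (hg : Measurable g)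
    (h0 : ∀ᵐ x ∂P, (g (G x 0 1, G x 1 0, G x 1 1)).1 ≠ 0) :
    ∀ᵐ x ∂P, G x 0 0 * (g (G x 0 1, G x 1 0, G x 1 1)).1 +
      (g (G x 0 1, G x 1 0, G x 1 1)).2 ≠ 0 :=
  ae_mul_add_ne_zero (R := fun x => g (G x 0 1, G x 1 0, G x 1 1)) (h.law_G 0 0)
    (hg.comp_aemeasurable ((h.law_G 0 1).aemeasurable.prodMk
      ((h.law_G 1 0).aemeasurable.prodMk (h.law_G 1 1).aemeasurable)))
    (h.indepFun_zero_zero.comp measurable_id hg) h0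

lemma ae_det_ne_zero (h : IsRayleigh P G H) : ∀ᵐ x ∂P, (G x).det ≠ 0 := by
  filter_upwards [h.ae_affine_ne_zero (g := fun r => (r.2.2, -(r.1 * r.2.1))) (by fun_prop)
    (h.ae_entry_ne_zero 1 1)] with x hx
  rwa [Matrix.det_fin_two, sub_eq_add_neg]

lemma ae_offDiag_ne_zero (h : IsRayleigh P G H) : ∀ᵐ x ∂P, (G x * (G x)ᴴ) 0 1 ≠ 0 := by
  have h1 : ∀ᵐ x ∂P, star (G x 1 0) ≠ 0 :=
    (h.ae_entry_ne_zero 1 0).mono fun x hx => star_ne_zero.2 hx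
  filter_upwards [h.ae_affine_ne_zero (g := fun r => (star r.2.1, r.1 * star r.2.2)) (by fun_prop)
    h1] with x hx
  simpa [Matrix.mul_apply] using hx

/-- Almost surely the singular values of a Rayleigh matrix are distinct and positive. -/
lemma ae_simple_spectrum (h : IsRayleigh P G H) {U V : Ω → Mat} {s : Ω → Fin 2 → ℝ}
    (hG : ∀ᵐ x ∂P, IsOrderedSVD (G x) (U x) (s x) (V x)) :
    ∀ᵐ x ∂P, s x 1 < s x 0 ∧ 0 < s x 1 := by
  filter_upwards [hG, h.ae_det_ne_zero, h.ae_offDiag_ne_zero] with x hx hd ho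
  refine ⟨hx.ordered.lt_of_ne fun he => ho ?_, hx.nonneg.lt_of_ne fun he => hd ?_⟩
  · simpa using hx.conjTranspose.gram_offDiag_eq_zero he.symm
  · exact hx.det_eq_zero he.symm

end IsRayleigh

/-! ### The mean SNR of admissible pairs -/

variable {Ω : Type*} [MeasurableSpace Ω] {P : Measure Ω} {G H : Ω → Mat}

/-- If the joint law of the channels is invariant under four transformations `τ r` which leave the
choice of `a`, `b` unchanged and which act on the received power as a unitary `1`-design between
the two channels, then the mean SNR decouples. -/
lemma integral_snr_of_invariant [IsProbabilityMeasure P] (h : IsRayleigh P G H) (ρ σ : ℝ)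
    (φ : Fin 2 → ℝ)
    {A B : Mat × Mat → Mat} (hA : Measurable A) (hB : Measurable B)
    (τ : Fin 2 × Fin 2 → Mat × Mat → Mat × Mat)
    (hτ : ∀ r, IsRayleigh P (fun x => (τ r (G x, H x)).1) (fun x => (τ r (G x, H x)).2))
    (hAτ : ∀ r p, A (τ r p) = A p) (hBτ : ∀ r p, B (τ r p) = B p)
    (hsum : ∀ p X Y, ∑ r, received φ (τ r p).1 (τ r p).2 X Y =
      (2 * (p.2 * X * p.2ᴴ).trace * (p.1ᴴ * Y * p.1).trace).re)
    {a b : Ω → Vec} (ha : ∀ᵐ x ∂P, Matrix.vecMulVec (a x) (star (a x)) = A (G x, H x))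
    (hb : ∀ᵐ x ∂P, Matrix.vecMulVec (b x) (star (b x)) = B (G x, H x))
    (hint : Integrable (fun x => received φ (G x) (H x) (A (G x, H x)) (B (G x, H x))) P) :
    Integrable (fun x => gain (G x)ᴴ (b x) * gain (H x) (a x)) P ∧
      ∫ x, snr ρ σ φ (G x) (H x) (a x) (b x) ∂P =
        ρ / σ ^ 2 / 2 * ∫ x, gain (G x)ᴴ (b x) * gain (H x) (a x) ∂P := by
  have hf : Measurable fun p : Mat × Mat => received φ p.1 p.2 (A p) (B p) :=
    measurable_received φ measurable_fst measurable_snd hA hB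
  have hid (r) := (h.identDistrib (hτ r)).comp hf
  have hint' (r) : Integrable (fun x => received φ (τ r (G x, H x)).1 (τ r (G x, H x)).2
      (A (τ r (G x, H x))) (B (τ r (G x, H x)))) P := (hid r).integrable_snd hint
  have hsum' : (fun x => ∑ r, received φ (τ r (G x, H x)).1 (τ r (G x, H x)).2
      (A (τ r (G x, H x))) (B (τ r (G x, H x)))) =ᵐ[P]
      fun x => 2 * (gain (G x)ᴴ (b x) * gain (H x) (a x)) := by
    filter_upwards [ha, hb] with x hax hbx
    have h1 := trace_gain (G x)ᴴ (b x)
    rw [Matrix.conjTranspose_conjTranspose] at h1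
    simp only [hAτ, hBτ, hsum, ← hax, ← hbx, trace_gain, h1]
    rw [mul_assoc, ← Complex.ofReal_mul, Complex.re_mul_ofReal, Complex.re_ofNat,
      mul_comm (gain (H x) (a x))]
  have hgain : Integrable (fun x => 2 * (gain (G x)ᴴ (b x) * gain (H x) (a x))) P :=
    (integrable_finsetSum _ fun r _ => hint' r).congr hsum'
  refine ⟨by simpa using hgain.const_mul (1 / 2), ?_⟩
  -- each of the four transformed integrands has the same mean as the original one
  have h4 : 2 * ∫ x, gain (G x)ᴴ (b x) * gain (H x) (a x) ∂P =
      4 * ∫ x, received φ (G x) (H x) (A (G x, H x)) (B (G x, H x)) ∂P := by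
    rw [← integral_const_mul, ← integral_congr_ae hsum', integral_finsetSum _ fun r _ => hint' r]
    have he (r) : ∫ x, received φ (τ r (G x, H x)).1 (τ r (G x, H x)).2
      (A (τ r (G x, H x))) (B (τ r (G x, H x))) ∂P = _ := (hid r).integral_eq.symm
    simp only [he]
    simp
  have h5 : ∫ x, snr ρ σ φ (G x) (H x) (a x) (b x) ∂P = ρ / σ ^ 2 *
      ∫ x, received φ (G x) (H x) (A (G x, H x)) (B (G x, H x)) ∂P := by
    rw [← integral_const_mul]
    refine integral_congr_ae ?_
    filter_upwards [ha, hb] with x hax hbx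
    rw [snr_eq_received, hax, hbx]
  rw [h5]
  linear_combination (-(ρ / σ ^ 2 / 4)) * h4

variable {U V W Q : Ω → Mat} {lam om : Ω → Fin 2 → ℝ}

lemma integrable_mul_sv (h : IsRayleigh P G H)
    (hG : ∀ᵐ x ∂P, IsOrderedSVD (G x) (U x) (lam x) (V x))
    (hH : ∀ᵐ x ∂P, IsOrderedSVD (H x) (W x) (om x) (Q x)) (i j : Fin 2) :
    Integrable (fun x => lam x j * om x i) P := by
  have hm {M : Ω → Mat} (hM : AEMeasurable M P) (k : Fin 2) :
      AEMeasurable (fun x => eig ((M x)ᴴ * M x) k) P :=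
    ((measurable_eig k).comp (measurable_mat_mul (measurable_mat_conjTranspose measurable_id)
      measurable_id)).comp_aemeasurable hM
  have hmeas : AEMeasurable (fun x => lam x j * om x i) P := by
    refine ((hm h.aemeasurable_left j).mul (hm h.aemeasurable_right i)).congr ?_
    filter_upwards [hG, hH] with x hGx hHx
    simp only [Pi.mul_apply, hGx.eig_gram, hHx.eig_gram]
  refine h.integrable_frobenius.mono' hmeas.aestronglyMeasurable ?_
  filter_upwards [hG, hH] with x hGx hHx
  rw [Real.norm_of_nonneg (mul_nonneg (hGx.nonneg' j) (hHx.nonneg' i))]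
  exact mul_le_mul (hGx.le_sum_sq j) (hHx.le_sum_sq i) (hHx.nonneg' i) (by positivity)

/-- For an admissible pair the mean SNR depends on the two channels only through the separate
gains `‖G† b‖²` and `‖H a‖²`. -/
lemma IsAdmissible.integral_snr [IsProbabilityMeasure P] {a b : Ω → Vec}
    (hab : IsAdmissible P G H a b) (h : IsRayleigh P G H)
    (hG : ∀ᵐ x ∂P, IsOrderedSVD (G x) (U x) (lam x) (V x))
    (hH : ∀ᵐ x ∂P, IsOrderedSVD (H x) (W x) (om x) (Q x))
    {ρ σ : ℝ} (hρ : 0 < ρ) (hσ : 0 < σ) (φ : Fin 2 → ℝ) :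
    Integrable (fun x => snr ρ σ φ (G x) (H x) (a x) (b x)) P ∧
    Integrable (fun x => gain (G x)ᴴ (b x) * gain (H x) (a x)) P ∧
      ∫ x, snr ρ σ φ (G x) (H x) (a x) (b x) ∂P =
        ρ / σ ^ 2 / 2 * ∫ x, gain (G x)ᴴ (b x) * gain (H x) (a x) ∂P := by
  have hc : ρ / σ ^ 2 ≠ 0 := by positivity
  have hGH : AEMeasurable (fun x => (G x, H x)) P :=
    h.aemeasurable_left.prodMk h.aemeasurable_right
  have hint {A B : Mat × Mat → Mat} (hA : Measurable A) (hB : Measurable B)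
      (ha : ∀ᵐ x ∂P, Matrix.vecMulVec (a x) (star (a x)) = A (G x, H x))
      (hb : ∀ᵐ x ∂P, Matrix.vecMulVec (b x) (star (b x)) = B (G x, H x)) :
      Integrable (fun x => snr ρ σ φ (G x) (H x) (a x) (b x)) P ∧
      Integrable (fun x => received φ (G x) (H x) (A (G x, H x)) (B (G x, H x))) P := by
    have he : (fun x => snr ρ σ φ (G x) (H x) (a x) (b x)) =ᵐ[P] fun x =>
        ρ / σ ^ 2 * received φ (G x) (H x) (A (G x, H x)) (B (G x, H x)) := by
      filter_upwards [ha, hb] with x hax hbx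
      rw [snr_eq_received, hax, hbx]
    have hf : Measurable fun p : Mat × Mat => received φ p.1 p.2 (A p) (B p) :=
      measurable_received φ measurable_fst measurable_snd hA hB
    have hm := hf.comp_aemeasurable hGH
    rw [Function.comp_def] at hm
    have hs : Integrable (fun x => snr ρ σ φ (G x) (H x) (a x) (b x)) P := by
      refine ((integrable_mul_sv h hG hH 0 0).const_mul (ρ / σ ^ 2)).mono'
        ((hm.const_mul _).congr he.symm).aestronglyMeasurable ?_
      filter_upwards [hG, hH, hab.unit_a, hab.unit_b] with x hGx hHx hax hbx
      rw [Real.norm_of_nonneg (snr_nonneg hρ φ _ _ _ _)]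
      have hgain : gain (G x)ᴴ (b x) * gain (H x) (a x) ≤ lam x 0 * om x 0 :=
        mul_le_mul (hGx.conjTranspose.gain_le hbx) (hHx.gain_le hax) (gain_nonneg _ _)
          (hGx.nonneg' 0)
      exact (snr_le hρ φ _ _ _ _).trans (mul_le_mul_of_nonneg_left hgain (by positivity))
    refine ⟨hs, ?_⟩
    have := (hs.congr he).const_mul (ρ / σ ^ 2)⁻¹
    simpa only [inv_mul_cancel_left₀ hc] using this
  -- multiplying `G` on the right preserves `G G†` and `H`; multiplying `H` on the left preserves
  -- `G` and `H† H`
  rcases hab.csi with ⟨⟨S, hS, ha⟩, T, hT, hb⟩ | ⟨⟨S, hS, ha⟩, T, hT, hb⟩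
  · have hX : Measurable fun p : Mat × Mat => (p.1 * p.1ᴴ, p.2) :=
      (measurable_mat_mul measurable_fst (measurable_mat_conjTranspose measurable_fst)).prodMk
        measurable_snd
    have hinv (r) (p : Mat × Mat) : (p.1 * weyl r) * (p.1 * weyl r)ᴴ = p.1 * p.1ᴴ := by
      rw [Matrix.conjTranspose_mul, mul_assoc, ← mul_assoc (weyl r), weyl_mul_conjTranspose,
        one_mul]
    obtain ⟨h1, h2⟩ := hint (hS.comp hX) (hT.comp hX) ha hb
    refine ⟨h1, integral_snr_of_invariant h ρ σ φ (hS.comp hX) (hT.comp hX)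
      (fun r p => (p.1 * weyl r, p.2)) h.mul_weyl ?_ ?_ ?_ ha hb h2⟩
    · intro r p
      simp only [Function.comp_apply, hinv]
    · intro r p
      simp only [Function.comp_apply, hinv]
    · exact fun p X Y => sum_received_mul_weyl φ p.1 p.2 X Y
  · have hX : Measurable fun p : Mat × Mat => (p.1, p.2ᴴ * p.2) :=
      measurable_fst.prodMk
        (measurable_mat_mul (measurable_mat_conjTranspose measurable_snd) measurable_snd)
    have hinv (r) (p : Mat × Mat) : (weyl r * p.2)ᴴ * (weyl r * p.2) = p.2ᴴ * p.2 := by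
      rw [Matrix.conjTranspose_mul, mul_assoc, ← mul_assoc _ (weyl r), conjTranspose_mul_weyl,
        one_mul]
    obtain ⟨h1, h2⟩ := hint (hS.comp hX) (hT.comp hX) ha hb
    refine ⟨h1, integral_snr_of_invariant h ρ σ φ (hS.comp hX) (hT.comp hX)
      (fun r p => (p.1, weyl r * p.2)) h.weyl_mul ?_ ?_ ?_ ha hb h2⟩
    · intro r p
      simp only [Function.comp_apply, hinv]
    · intro r p
      simp only [Function.comp_apply, hinv]
    · exact fun p X Y => sum_received_weyl_mul φ p.1 p.2 X Y

/-- The singular values are almost surely distinct, so the projections onto the singular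
directions are functions of `G G†` and `H† H`. -/
lemma isAdmissible_column [IsProbabilityMeasure P] (h : IsRayleigh P G H)
    (hG : ∀ᵐ x ∂P, IsOrderedSVD (G x) (U x) (lam x) (V x))
    (hH : ∀ᵐ x ∂P, IsOrderedSVD (H x) (W x) (om x) (Q x)) (i j : Fin 2) :
    IsAdmissible P G H (column Q i) (column U j) where
  unit_a := hH.mono fun x hx => hx.unit_col i
  unit_b := hG.mono fun x hx => hx.conjTranspose.unit_col j
  csi := by
    refine Or.inl ⟨⟨fun p => eigProj (p.2ᴴ * p.2) i, (measurable_eigProj i).comp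
      (measurable_mat_mul (measurable_mat_conjTranspose measurable_snd) measurable_snd), ?_⟩,
      fun p => eigProj p.1 j, (measurable_eigProj j).comp measurable_fst, ?_⟩
    · filter_upwards [hH, h.swap.ae_simple_spectrum hH] with x hx hs
      exact hx.eigProj_gram hs.1 i
    · filter_upwards [hG, h.ae_simple_spectrum hG] with x hx hs
      have := hx.conjTranspose.eigProj_gram hs.1 j
      rwa [Matrix.conjTranspose_conjTranspose] at this

/-- `E[λ_j ω_i]` is symmetric in `i`, `j`, because exchanging the two channels preserves their
joint law and the squared singular values are functions of the Gram matrices. -/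
lemma integral_sv_symm [IsProbabilityMeasure P] (h : IsRayleigh P G H)
    (hG : ∀ᵐ x ∂P, IsOrderedSVD (G x) (U x) (lam x) (V x))
    (hH : ∀ᵐ x ∂P, IsOrderedSVD (H x) (W x) (om x) (Q x)) (i j : Fin 2) :
    ∫ x, lam x j * om x i ∂P = ∫ x, lam x i * om x j ∂P := by
  have he (i j : Fin 2) : ∫ x, lam x j * om x i ∂P =
      ∫ x, eig ((G x)ᴴ * G x) j * eig ((H x)ᴴ * H x) i ∂P := by
    refine integral_congr_ae ?_
    filter_upwards [hG, hH] with x hGx hHx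
    rw [hGx.eig_gram, hHx.eig_gram]
  have hm (i : Fin 2) : Measurable fun M : Mat => eig (Mᴴ * M) i :=
    (measurable_eig i).comp (measurable_mat_mul (measurable_mat_conjTranspose measurable_id)
      measurable_id)
  rw [he, he]
  have := ((h.identDistrib h.swap).comp (((hm j).comp measurable_fst).mul
    ((hm i).comp measurable_snd))).integral_eq
  simpa [mul_comm] using this

lemma integral_lt_of_ae_lt [IsProbabilityMeasure P] {f g : Ω → ℝ} (hf : Integrable f P)
    (hg : Integrable g P) (h : ∀ᵐ x ∂P, f x < g x) : ∫ x, f x ∂P < ∫ x, g x ∂P := by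
  rw [← sub_pos, ← integral_sub hg hf, integral_pos_iff_support_of_nonneg_ae
    (h.mono fun x hx => (sub_pos.2 hx).le) (hg.sub hf)]
  have : Function.support (fun x => g x - f x) =ᵐ[P] Set.univ :=
    Filter.eventuallyEq_univ.2 (h.mono fun x hx => (sub_pos.2 hx).ne')
  rw [measure_congr this]
  simp

end RIS

theorem theorem1 {Ω : Type*} [MeasurableSpace Ω] (P : Measure Ω) [IsProbabilityMeasure P]
    (G H : Ω → RIS.Mat) (hGH : RIS.IsRayleigh P G H)
    (φ : Fin 2 → ℝ) (ρ σ : ℝ) (hρ : 0 < ρ) (hσ : 0 < σ)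
    (U V W Q : Ω → RIS.Mat) (lam om : Ω → Fin 2 → ℝ)
    (hG : ∀ᵐ x ∂P, RIS.IsOrderedSVD (G x) (U x) (lam x) (V x))
    (hH : ∀ᵐ x ∂P, RIS.IsOrderedSVD (H x) (W x) (om x) (Q x)) :
    -- every pair of singular vectors is admissible
    (∀ i j, RIS.IsAdmissible P G H (RIS.column Q i) (RIS.column U j)) ∧
    -- `(q₁, u₁)` maximizes and `(q₂, u₂)` minimizes the average SNR
    (∀ a b : Ω → RIS.Vec, RIS.IsAdmissible P G H a b →
      Integrable (fun x => RIS.snr ρ σ φ (G x) (H x) (a x) (b x)) P ∧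
      ∫ x, RIS.snr ρ σ φ (G x) (H x) (a x) (b x) ∂P ≤
        ∫ x, RIS.snr ρ σ φ (G x) (H x) (RIS.column Q 0 x) (RIS.column U 0 x) ∂P ∧
      ∫ x, RIS.snr ρ σ φ (G x) (H x) (RIS.column Q 1 x) (RIS.column U 1 x) ∂P ≤
        ∫ x, RIS.snr ρ σ φ (G x) (H x) (a x) (b x) ∂P) ∧
    -- the SNR of the pair `(q_i, u_j)`
    (∀ i j, (∀ᵐ x ∂P, RIS.snr ρ σ φ (G x) (H x) (RIS.column Q i x) (RIS.column U j x) =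
        RIS.modeSnr ρ σ φ (lam x) (om x) (V x) (W x) i j) ∧
      Integrable (fun x => RIS.modeSnr ρ σ φ (lam x) (om x) (V x) (W x) i j) P) ∧
    -- the order of the averages
    (∫ x, RIS.modeSnr ρ σ φ (lam x) (om x) (V x) (W x) 0 1 ∂P <
        ∫ x, RIS.modeSnr ρ σ φ (lam x) (om x) (V x) (W x) 0 0 ∂P ∧
      ∫ x, RIS.modeSnr ρ σ φ (lam x) (om x) (V x) (W x) 0 1 ∂P =
        ∫ x, RIS.modeSnr ρ σ φ (lam x) (om x) (V x) (W x) 1 0 ∂P ∧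
      ∫ x, RIS.modeSnr ρ σ φ (lam x) (om x) (V x) (W x) 1 1 ∂P <
        ∫ x, RIS.modeSnr ρ σ φ (lam x) (om x) (V x) (W x) 1 0 ∂P) := by
  have hc : 0 < ρ / σ ^ 2 / 2 := by positivity
  have hadm := RIS.isAdmissible_column hGH hG hH
  have hint := RIS.integrable_mul_sv hGH hG hH
  have hsnr (i j : Fin 2) : (fun x => RIS.snr ρ σ φ (G x) (H x) (RIS.column Q i x)
      (RIS.column U j x)) =ᵐ[P] fun x => RIS.modeSnr ρ σ φ (lam x) (om x) (V x) (W x) i j := by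
    filter_upwards [hG, hH] with x hGx hHx
    exact RIS.snr_col hGx hHx ρ σ φ i j
  have hcol (i j : Fin 2) : ∫ x, RIS.snr ρ σ φ (G x) (H x) (RIS.column Q i x)
      (RIS.column U j x) ∂P = ρ / σ ^ 2 / 2 * ∫ x, lam x j * om x i ∂P := by
    rw [((hadm i j).integral_snr hGH hG hH hρ hσ φ).2.2]
    congr 1
    refine integral_congr_ae ?_
    filter_upwards [hG, hH] with x hGx hHx
    exact congrArg₂ (· * ·) (hGx.conjTranspose.gain_col j) (hHx.gain_col i)
  have hmode (i j : Fin 2) : ∫ x, RIS.modeSnr ρ σ φ (lam x) (om x) (V x) (W x) i j ∂P =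
      ρ / σ ^ 2 / 2 * ∫ x, lam x j * om x i ∂P := by
    rw [← hcol, integral_congr_ae (hsnr i j)]
  refine ⟨hadm, fun a b hab => ?_, fun i j => ⟨hsnr i j, ?_⟩, ?_, ?_, ?_⟩
  · obtain ⟨h1, h2, h3⟩ := hab.integral_snr hGH hG hH hρ hσ φ
    rw [h3, hcol, hcol]
    refine ⟨h1, mul_le_mul_of_nonneg_left (integral_mono_ae h2 (hint 0 0) ?_) hc.le,
      mul_le_mul_of_nonneg_left (integral_mono_ae (hint 1 1) h2 ?_) hc.le⟩
    · filter_upwards [hG, hH, hab.unit_a, hab.unit_b] with x hGx hHx hax hbx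
      exact mul_le_mul (hGx.conjTranspose.gain_le hbx) (hHx.gain_le hax) (RIS.gain_nonneg _ _)
        (hGx.nonneg' 0)
    · filter_upwards [hG, hH, hab.unit_a, hab.unit_b] with x hGx hHx hax hbx
      exact mul_le_mul (hGx.conjTranspose.le_gain hbx) (hHx.le_gain hax) hHx.nonneg
        (RIS.gain_nonneg _ _)
  · exact ((hadm i j).integral_snr hGH hG hH hρ hσ φ).1.congr (hsnr i j)
  · rw [hmode, hmode]
    refine mul_lt_mul_of_pos_left (RIS.integral_lt_of_ae_lt (hint 0 1) (hint 0 0) ?_) hc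
    filter_upwards [hGH.ae_simple_spectrum hG, hGH.swap.ae_simple_spectrum hH] with x hl ho
    exact mul_lt_mul_of_pos_right hl.1 (ho.2.trans ho.1)
  · rw [hmode, hmode, RIS.integral_sv_symm hGH hG hH]
  · rw [hmode, hmode, RIS.integral_sv_symm hGH hG hH 1 0]
    refine mul_lt_mul_of_pos_left (RIS.integral_lt_of_ae_lt (hint 1 1) (hint 0 1) ?_) hc
    filter_upwards [hGH.ae_simple_spectrum hG, hGH.swap.ae_simple_spectrum hH] with x hl ho
    exact mul_lt_mul_of_pos_left ho.1 hl.2
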